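/- Call \emph{weight function} any continuous non-decreasing function $w:[0,\infty)\to(0,\infty)$. For a weight function $w$ such that $W(x):=\int_0^x \frac{du}{w(u)}$ tends to $+\infty$ as $x\to\infty$, let $W^{-1}$ be the inverse of the bijection $W:[0,\infty)\to[0,\infty)$; for a measurable $f:[0,\infty)\to[0,\infty)$ set $$G(f)(x):=\int_0^x\frac{w(W^{-1}(f(u)))}{w(W^{-1}(u))}\,du ,$$ and for $\eta\in(0,1)$ define, with $G^{(n)}$ the $n$-fold iterate of $G$, $\mathrm{Id}$ the identity function and $\inf\emptyset=+\infty$, $$i_\eta(w):=\inf\{n\ge 2 : G^{(n-1)}(\eta\,\mathrm{Id})\text{ is bounded}\},\qquad i_\pm(w):=\lim_{\eta\to\frac12^\pm} i_\eta(w).$$ The vertex reinforced random walk (VRRW) on $\mathbb Z$ with weight $w$ is the process $(X_n)_{n\ge0}$ with $X_0=0$ which, given $X_0,\dots,X_n$, jumps to $X_n\pm1$ with probabilities $$\frac{w(Z_n(X_n\pm1))}{w(Z_n(X_n-1))+w(Z_n(X_n+1))},\qquad Z_n(y):=\#\{0\le i\le n : X_i=y\}.$$ It localizes if the set of sites it visits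 is finite. Let $\tilde w$ be a weight function such that $\tilde w(x)=x\exp\left(-\frac{\log x}{\log\log x}\right)$ for all sufficiently large $x$. Then: (1) $i_-(\tilde w)=i_+(\tilde w)=+\infty$; (2) almost surely, the VRRW with weight $\tilde w$ does not localize; (3) for every $\alpha<1$, $\tilde w(x)=o\left(\frac{x}{\exp((\log x)^\alpha)}\right)$ as $x\to\infty$. -/

import Mathlib

open Real Set Filter Topology MeasureTheory ProbabilityTheory Asymptotics

namespace VRRW

/-- A weight function: a continuous, non-decreasing function `[0,∞) → (0,∞)`.
Only the values on `[0,∞)` of the total function `w : ℝ → ℝ` matter. -/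
structure IsWeightFunction (w : ℝ → ℝ) : Prop where
  continuousOn : ContinuousOn w (Ici 0)
  monotoneOn : MonotoneOn w (Ici 0)
  pos : ∀ x, 0 ≤ x → 0 < w x

/-- The primitive `W(x) = ∫₀ˣ du / w(u)`, for `x ≥ 0`. -/
noncomputable def W (w : ℝ → ℝ) (x : ℝ) : ℝ :=
  ∫ u in (0 : ℝ)..x, 1 / w u

/-- The inverse `W⁻¹ : [0,∞) → [0,∞)` of `W`. For a weight function `w`, `W` is strictly increasing
and continuous on `[0,∞)` with `W(0) = 0`, so it is a bijection of `[0,∞)` as soon as it is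
unbounded, as is the case when `w(x) ≤ x` for large `x`. -/
noncomputable def Winv (w : ℝ → ℝ) : ℝ → ℝ :=
  Function.invFunOn (W w) (Ici 0)

/-- The operator `G(f)(x) = ∫₀ˣ w(W⁻¹(f(u))) / w(W⁻¹(u)) du`. -/
noncomputable def G (w : ℝ → ℝ) (f : ℝ → ℝ) (x : ℝ) : ℝ :=
  ∫ u in (0 : ℝ)..x, w (Winv w (f u)) / w (Winv w u)

/-- The index `i_η(w) = inf {n ≥ 2 : G^(n-1)(η Id) is bounded on [0,∞)}`, with `inf ∅ = ∞`. -/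
noncomputable def index (w : ℝ → ℝ) (η : ℝ) : ℕ∞ :=
  sInf ((fun n : ℕ => (n : ℕ∞)) ''
    {n : ℕ | 2 ≤ n ∧ ∃ C : ℝ, ∀ x, 0 ≤ x → |((G w)^[n - 1] (fun u => η * u)) x| ≤ C})

/-- `visits x n y` is the number of visits of the path `x` to the site `y` up to time `n`
(times `0` and `n` included). -/
def visits (x : ℕ → ℤ) (n : ℕ) (y : ℤ) : ℕ :=
  ((Finset.range (n + 1)).filter fun i => x i = y).card

/-- The event that `X` follows the path `x` up to time `n`. -/
def history {Ω : Type*} (X : ℕ → Ω → ℤ) (x : ℕ → ℤ) (n : ℕ) : Set Ω :=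
  {ω | ∀ i ≤ n, X i ω = x i}

/-- `X` is, under `μ`, a vertex reinforced random walk on `ℤ` started from `0` with weight
sequence `w`: given its past up to time `n`, it jumps to one of the two neighbours of its current
position, with probabilities proportional to the weights `w` of their numbers of visits. -/
structure IsVRRW {Ω : Type*} [MeasurableSpace Ω] (w : ℕ → ℝ) (X : ℕ → Ω → ℤ)
    (μ : Measure Ω) : Prop where
  measurable : ∀ n, Measurable (X n)
  start : ∀ᵐ ω ∂μ, X 0 ω = 0
  left : ∀ (n : ℕ) (x : ℕ → ℤ), μ (history X x n) ≠ 0 →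
    μ[{ω | X (n + 1) ω = x n - 1} | history X x n] =
      ENNReal.ofReal (w (visits x n (x n - 1)) /
        (w (visits x n (x n - 1)) + w (visits x n (x n + 1))))
  right : ∀ (n : ℕ) (x : ℕ → ℤ), μ (history X x n) ≠ 0 →
    μ[{ω | X (n + 1) ω = x n + 1} | history X x n] =
      ENNReal.ofReal (w (visits x n (x n + 1)) /
        (w (visits x n (x n - 1)) + w (visits x n (x n + 1))))

/-- A path localizes if its range is finite. -/
def Localizes (x : ℕ → ℤ) : Prop := (Set.range x).Finite

end VRRW

namespace VRRW

/-! ### Comparison of logarithms and powers -/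

/-! Everything rests on one stability property: losses of the form `exp (-(log x)^b)` with `b < 1`
stay of this form, with a larger exponent still below 1, when carried through `W`, `W⁻¹` and `w`.
Indeed `x / w x = exp (log x / log log x)`, and `W x` agrees with it up to a factor `log² x`. Since
`t / log t` has slope at least `1 / (2 log t)`, a factor `exp (-t^a)` in `W`, with `t = log x`,
costs only `exp (-6 t^a log t)` in the argument (`eventually_le_of_le_W`), and `w p / w m ≥ p / m`
for large `p ≤ m`.

Hence `G` preserves the class `AlmostLinear`, whose members are unbounded; as `η Id` belongs to it,
the index is infinite for every `η > 0`.

For the walk, `energy` has expectation at most 1, so by Fatou the energies of any finite set of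
sites are almost surely bounded together along infinitely many times `n`. At such times `Z(y) / w n
≤ 4 W (Z(y+1)) + C`, where `Z` counts visits. If the range lay in `[-N, N]`, some site would have a
positive fraction of the visits; the inequality would pass an almost linear number of visits from
each site to its right neighbour, and finally to `N + 1`, which is never visited. -/

theorem eventually_mul_rpow_mul_log_le {a b : ℝ} (hab : a < b) (c : ℝ) :
    ∀ᶠ t : ℝ in atTop, c * t ^ a * log t ≤ t ^ b := by
  have h := (isLittleO_log_rpow_atTop (sub_pos.2 hab)).bound
    (c := (|c| + 1)⁻¹) (by positivity)
  filter_upwards [h, eventually_ge_atTop 1] with t ht h1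
  have h0 : 0 < t := by linarith
  have hl : 0 ≤ log t := log_nonneg h1
  rw [norm_of_nonneg hl, norm_of_nonneg (by positivity), inv_mul_eq_div,
    le_div_iff₀ (by positivity)] at ht
  have e : t ^ b = t ^ a * t ^ (b - a) := by rw [← rpow_add h0]; congr 1; ring
  rw [e]
  calc c * t ^ a * log t ≤ (|c| + 1) * t ^ a * log t := by
        gcongr; linarith [le_abs_self c]
    _ = t ^ a * (log t * (|c| + 1)) := by ring
    _ ≤ _ := by gcongr

theorem eventually_mul_rpow_le {a b : ℝ} (hab : a < b) (c : ℝ) :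
    ∀ᶠ t : ℝ in atTop, c * t ^ a ≤ t ^ b := by
  filter_upwards [eventually_mul_rpow_mul_log_le hab |c|, eventually_ge_atTop (exp 1),
    eventually_gt_atTop 0] with t ht h1 h0
  have hl : 1 ≤ log t := by rwa [le_log_iff_exp_le h0]
  have : c * t ^ a ≤ |c| * t ^ a := by gcongr; exact le_abs_self c
  have h2 : |c| * t ^ a * 1 ≤ |c| * t ^ a * log t := by gcongr
  linarith

theorem eventually_mul_log_le {b : ℝ} (hb : 0 < b) (c : ℝ) :
    ∀ᶠ t : ℝ in atTop, c * log t ≤ t ^ b := by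
  filter_upwards [eventually_mul_rpow_mul_log_le hb c] with t ht
  simpa using ht

/-- The derivative `(log u - 1) / log² u` of `u / log u` is at least `1 / (2 log u)` once `log u ≥
2`. The inequality `log (t / s) ≤ t / s - 1` replaces the calculus. -/
theorem div_log_sub_div_log_ge {s t : ℝ} (hs : exp 2 ≤ s) (hst : s ≤ t) :
    (t - s) / (2 * log t) ≤ t / log t - s / log s := by
  have s0 : 0 < s := (exp_pos 2).trans_le hs
  have t0 : 0 < t := s0.trans_le hst
  have ls : 2 ≤ log s := by rwa [le_log_iff_exp_le s0]
  have lt : log s ≤ log t := log_le_log s0 hst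
  have h1 : s * (log t - log s) ≤ t - s := by
    have := log_le_sub_one_of_pos (div_pos t0 s0)
    rw [log_div t0.ne' s0.ne'] at this
    calc s * (log t - log s) ≤ s * (t / s - 1) := by gcongr
      _ = t - s := by field_simp
  have p1 : 0 < log s := by linarith
  have p2 : 0 < log t := by linarith
  rw [div_sub_div _ _ p2.ne' p1.ne', div_le_div_iff₀ (by positivity) (by positivity)]
  have h2 : (t - s) * log s ≤ 2 * (t * log s - log t * s) := by
    nlinarith [mul_nonneg (sub_nonneg.2 hst) (sub_nonneg.2 ls)]
  calc (t - s) * (log t * log s) = ((t - s) * log s) * log t := by ring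
    _ ≤ (2 * (t * log s - log t * s)) * log t := by gcongr
    _ = _ := by ring

theorem div_log_le_div_log {s t : ℝ} (hs : exp 2 ≤ s) (hst : s ≤ t) :
    s / log s ≤ t / log t := by
  have h := div_log_sub_div_log_ge hs hst
  have : 0 ≤ (t - s) / (2 * log t) := by
    have : 1 ≤ t := by
      have := add_one_le_exp (2 : ℝ)
      linarith
    have := log_nonneg this
    have := sub_nonneg.2 hst
    positivity
  linarith

/-! ### The primitive `W` -/

section Primitive

variable {w : ℝ → ℝ}

theorem IsWeightFunction.continuousOn_inv (hw : IsWeightFunction w) :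
    ContinuousOn (fun u => 1 / w u) (Ici 0) :=
  continuousOn_const.div hw.continuousOn fun x hx => (hw.pos x hx).ne'

theorem IsWeightFunction.intervalIntegrable_inv (hw : IsWeightFunction w) {a b : ℝ}
    (ha : 0 ≤ a) (hb : 0 ≤ b) : IntervalIntegrable (fun u => 1 / w u) volume a b :=
  (hw.continuousOn_inv.mono fun _ hx => (le_min ha hb).trans hx.1).intervalIntegrable

theorem W_zero : W w 0 = 0 := by simp [W]

theorem IsWeightFunction.W_add_integral (hw : IsWeightFunction w) {a b : ℝ}
    (ha : 0 ≤ a) (hb : 0 ≤ b) : W w a + ∫ u in a..b, 1 / w u = W w b :=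
  intervalIntegral.integral_add_adjacent_intervals
    (hw.intervalIntegrable_inv le_rfl ha) (hw.intervalIntegrable_inv ha hb)

theorem IsWeightFunction.sub_div_le_integral (hw : IsWeightFunction w) {a b : ℝ}
    (ha : 0 ≤ a) (hab : a ≤ b) : (b - a) / w b ≤ ∫ u in a..b, 1 / w u := by
  have hb := ha.trans hab
  have := intervalIntegral.integral_mono_on (f := fun _ => 1 / w b) hab (by simp)
    (hw.intervalIntegrable_inv ha hb) (fun u hu => by
      have h0 : 0 ≤ u := ha.trans hu.1
      exact one_div_le_one_div_of_le (hw.pos u h0) (hw.monotoneOn h0 hb hu.2))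
  simpa [div_eq_mul_inv] using this

theorem IsWeightFunction.strictMonoOn_W (hw : IsWeightFunction w) :
    StrictMonoOn (W w) (Ici 0) := by
  intro a ha b hb hab
  have h := hw.sub_div_le_integral ha hab.le
  have : 0 < (b - a) / w b := div_pos (sub_pos.2 hab) (hw.pos b hb)
  linarith [hw.W_add_integral (mem_Ici.1 ha) (mem_Ici.1 hb)]

theorem IsWeightFunction.div_le_W (hw : IsWeightFunction w) {x : ℝ} (hx : 0 ≤ x) :
    x / w x ≤ W w x := by
  simpa [W] using hw.sub_div_le_integral le_rfl hx

theorem IsWeightFunction.continuousOn_W (hw : IsWeightFunction w) :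
    ContinuousOn (W w) (Ici 0) := by
  intro x hx
  have hx0 : (0 : ℝ) ≤ x := hx
  have h := intervalIntegral.continuousOn_primitive_interval (a := 0) (b := x + 1)
    (f := fun u => 1 / w u) (μ := volume) (by
      rw [uIcc_of_le (by linarith)]
      exact (hw.continuousOn_inv.mono Icc_subset_Ici_self).integrableOn_Icc)
  rw [uIcc_of_le (by linarith)] at h
  refine (h x ⟨hx0, by linarith⟩).mono_of_mem_nhdsWithin ?_
  exact mem_nhdsWithin.2 ⟨Iio (x + 1), isOpen_Iio, by simp, fun y hy => ⟨hy.2, hy.1.le⟩⟩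

end Primitive

/-! ### Weights asymptotic to `x exp (-(log x / log (log x)))` -/

section Asymptotics

variable {w : ℝ → ℝ}

theorem eventually_div_weight
    (hlarge : ∀ᶠ x : ℝ in atTop, w x = x * exp (-(log x / log (log x)))) :
    ∀ᶠ x in atTop, x / w x = exp (log x / log (log x)) := by
  filter_upwards [hlarge, eventually_gt_atTop 0] with x hx h0
  rw [hx, exp_neg]
  field_simp

/-- Beyond some `u₀`, the integrand is `exp (log u / log log u) / u` with increasing numerator, so
the integral is at most its final numerator times `log (x / u₀)`. The second factor `log x` absorbs
the constants. -/
theorem IsWeightFunction.eventually_W_le (hw : IsWeightFunction w)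
    (hlarge : ∀ᶠ x : ℝ in atTop, w x = x * exp (-(log x / log (log x)))) :
    ∀ᶠ x in atTop, W w x ≤ exp (log x / log (log x)) * log x ^ 2 := by
  obtain ⟨u₀, hu₀⟩ := eventually_atTop.1 ((eventually_div_weight hlarge).and
    ((eventually_gt_atTop 0).and (tendsto_log_atTop.eventually_ge_atTop (exp 2))))
  have hu0 : 0 < u₀ := (hu₀ u₀ le_rfl).2.1
  have hL : ∀ᶠ x : ℝ in atTop, |W w u₀| + |log u₀| + 1 ≤ log x :=
    tendsto_log_atTop.eventually_ge_atTop _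
  filter_upwards [eventually_ge_atTop u₀, hL] with x hx hlx
  have hx0 : 0 < x := hu0.trans_le hx
  have h1 : ∫ u in u₀..x, 1 / w u ≤ ∫ u in u₀..x, exp (log x / log (log x)) * (1 / u) := by
    refine intervalIntegral.integral_mono_on hx
      (hw.intervalIntegrable_inv hu0.le hx0.le) ?_ ?_
    · refine (ContinuousOn.intervalIntegrable ?_)
      rw [uIcc_of_le hx]
      exact continuousOn_const.mul (continuousOn_const.div continuousOn_id
        fun y hy => (hu0.trans_le hy.1).ne')
    · intro u hu
      obtain ⟨e, h0, hl⟩ := hu₀ u hu.1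
      have : 1 / w u = exp (log u / log (log u)) * (1 / u) := by
        rw [← e]; field_simp
      rw [this]
      exact mul_le_mul_of_nonneg_right
        (exp_le_exp.2 (div_log_le_div_log hl (log_le_log h0 hu.2))) (one_div_pos.2 h0).le
  rw [intervalIntegral.integral_const_mul, integral_one_div_of_pos hu0 hx0,
    log_div hx0.ne' hu0.ne'] at h1
  have h2 := hw.W_add_integral hu0.le hx0.le
  have hlx1 : 1 ≤ log x := by linarith [abs_nonneg (W w u₀), abs_nonneg (log u₀)]
  have hE : 1 ≤ exp (log x / log (log x)) :=
    one_le_exp (div_nonneg (by linarith) (log_nonneg hlx1))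
  set E := exp (log x / log (log x))
  calc W w x ≤ |W w u₀| + E * (log x + |log u₀|) := by
        rw [← h2]
        gcongr
        · exact le_abs_self _
        · refine h1.trans ?_
          gcongr
          linarith [neg_abs_le (log u₀)]
    _ ≤ E * |W w u₀| + E * (log x + |log u₀|) := by
        gcongr
        exact le_mul_of_one_le_left (abs_nonneg _) hE
    _ = E * (|W w u₀| + |log u₀| + log x) := by ring
    _ ≤ E * log x ^ 2 := by
        gcongr
        nlinarith [abs_nonneg (W w u₀), abs_nonneg (log u₀)]

end Asymptotics
-- Almost linear functions: transfer through `W` and stability under `G`.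
section AlmostLinear

variable {w f : ℝ → ℝ}

theorem tendsto_mul_exp_neg_log_rpow {b : ℝ} (hb : b < 1) :
    Tendsto (fun x : ℝ => x * exp (-(log x) ^ b)) atTop atTop := by
  have h1 : ∀ᶠ x : ℝ in atTop, exp (log x / 2) ≤ x * exp (-(log x) ^ b) := by
    filter_upwards [tendsto_log_atTop.eventually (eventually_mul_rpow_le hb 2),
      eventually_gt_atTop 0] with x hx h0
    rw [rpow_one] at hx
    nth_rewrite 2 [← exp_log h0]
    rw [← exp_add, exp_le_exp]
    linarith
  refine tendsto_atTop_mono' _ h1 (tendsto_exp_atTop.comp ?_)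
  exact tendsto_log_atTop.atTop_div_const (by norm_num)

/-- With `t = log m` and `s = log p ≤ t`, the bounds on `W` give `t / log t - s / log s ≤ t^a + 2
log s ≤ 3 t^a`, whence `t - s ≤ 6 t^a log t ≤ t^b`. -/
theorem IsWeightFunction.eventually_le_of_le_W (hw : IsWeightFunction w)
    (hlarge : ∀ᶠ x : ℝ in atTop, w x = x * exp (-(log x / log (log x)))) {a b : ℝ}
    (ha : 0 < a) (hab : a < b) (ha1 : a < 1) :
    ∀ᶠ m in atTop, ∀ p, 0 ≤ p → m / w m * exp (-(log m) ^ a) ≤ W w p →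
      m * exp (-(log m) ^ b) ≤ p := by
  obtain ⟨x₀, hx₀⟩ := eventually_atTop.1 ((hw.eventually_W_le hlarge).and
    ((eventually_gt_atTop 0).and (tendsto_log_atTop.eventually_ge_atTop (exp 2))))
  filter_upwards [eventually_div_weight hlarge, eventually_gt_atTop 0,
    tendsto_log_atTop.eventually (eventually_gt_atTop (exp 2)),
    tendsto_log_atTop.eventually (eventually_mul_rpow_mul_log_le ha1 2),
    tendsto_log_atTop.eventually (eventually_mul_rpow_mul_log_le hab 6),
    tendsto_log_atTop.eventually (eventually_mul_rpow_le ha (W w x₀)),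
    tendsto_log_atTop.eventually (eventually_mul_log_le ha 1)] with m h1 h0 h2 h3 h4 h5 h6
  intro p hp hW
  rw [h1, ← exp_add] at hW
  set t := log m
  have t0 : 0 < t := (exp_pos 2).trans h2
  have lt : 2 < log t := by rwa [lt_log_iff_exp_lt t0]
  rw [rpow_one, ← le_div_iff₀ (by linarith)] at h3
  rw [rpow_zero, mul_one] at h5
  rcases le_total m p with hmp | hpm
  · refine le_trans (mul_le_of_le_one_right h0.le ?_) hmp
    rw [exp_le_one_iff]
    have := rpow_nonneg t0.le b
    linarith
  -- A bounded `p` is impossible: the lower bound assumed for `W w p` exceeds `W w x₀`.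
  have hxp : x₀ ≤ p := by
    by_contra! h
    have h7 := hw.strictMonoOn_W.monotoneOn hp (hx₀ x₀ le_rfl).2.1.le h.le
    have h8 := add_one_le_exp (t / log t + -t ^ a)
    linarith
  obtain ⟨e, p0, pl⟩ := hx₀ p hxp
  set s := log p
  have s0 : 0 < s := (exp_pos 2).trans_le pl
  have hst : s ≤ t := log_le_log p0 hpm
  have h7 := div_log_sub_div_log_ge pl hst
  have h8 : log s ≤ log t := log_le_log s0 hst
  have h9 : t / log t + -t ^ a ≤ s / log s + 2 * log s := by
    rw [← exp_le_exp]
    refine (hW.trans e).trans_eq ?_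
    rw [exp_add, two_mul, exp_add, exp_log s0, sq]
  have h10 : (t - s) / (2 * log t) ≤ 3 * t ^ a := by linarith
  rw [div_le_iff₀ (by linarith)] at h10
  rw [← exp_log h0, ← exp_log p0, ← exp_add, exp_le_exp]
  change t + -t ^ b ≤ s
  linarith

/-- This is the bound on the integrand of `G`, with `m = W⁻¹(u)` and `p = W⁻¹(f(u))`. As `x / w x`
is eventually increasing, `w p / w m ≥ p / m` when `p ≤ m`. -/
theorem IsWeightFunction.eventually_weight_ratio (hw : IsWeightFunction w)
    (hlarge : ∀ᶠ x : ℝ in atTop, w x = x * exp (-(log x / log (log x)))) {a b : ℝ}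
    (ha : 0 < a) (hab : a < b) (hb : b < 1) :
    ∀ᶠ m in atTop, ∀ p, 0 ≤ p → W w m * exp (-(log (W w m)) ^ a) ≤ W w p →
      exp (-(log (W w m)) ^ b) ≤ w p / w m := by
  obtain ⟨c, hac, hcb⟩ := exists_between hab
  have c0 : 0 < c := ha.trans hac
  have b0 : 0 < b := c0.trans hcb
  obtain ⟨x₀, hx₀⟩ := eventually_atTop.1 ((eventually_div_weight hlarge).and
    ((eventually_gt_atTop 0).and (tendsto_log_atTop.eventually_ge_atTop (exp 2))))
  have hcb' : c / b < 1 := (div_lt_one b0).2 hcb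
  filter_upwards [hw.eventually_le_of_le_W hlarge ha hac (by linarith),
    (tendsto_mul_exp_neg_log_rpow (hcb.trans hb)).eventually_ge_atTop x₀,
    eventually_ge_atTop x₀, hw.eventually_W_le hlarge,
    tendsto_log_atTop.eventually (eventually_mul_rpow_mul_log_le hcb' 1),
    tendsto_log_atTop.eventually (eventually_mul_log_le one_pos 4)] with m h1 h2 h3 h4 h5 h6
  intro p hp hW
  obtain ⟨e, m0, ml⟩ := hx₀ m h3
  have hWl := hw.div_le_W m0.le
  rw [e] at hWl
  have W0 : 0 < W w m := (exp_pos _).trans_le hWl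
  set t := log m
  have t0 : 0 < t := (exp_pos 2).trans_le ml
  have lt : 2 ≤ log t := by rwa [le_log_iff_exp_le t0]
  have hlogl : t / log t ≤ log (W w m) := by rwa [le_log_iff_exp_le W0]
  have hdiv : 0 < t / log t := div_pos t0 (by linarith)
  rw [rpow_one] at h5 h6
  have hlogu : log (W w m) ≤ t := by
    have h7 : W w m ≤ exp (t / log t + 2 * log t) := by
      refine h4.trans_eq ?_
      rw [exp_add, two_mul, exp_add, exp_log t0, sq]
    have h8 : t / log t ≤ t / 2 := by gcongr
    rw [log_le_iff_le_exp W0]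
    exact h7.trans (exp_le_exp.2 (by linarith))
  have hp1 : m * exp (-t ^ c) ≤ p := by
    refine h1 p hp (le_trans ?_ hW)
    rw [e]
    have : log (W w m) ^ a ≤ t ^ a := rpow_le_rpow (hdiv.le.trans hlogl) hlogu ha.le
    gcongr
  -- Passing from `log m` to `log (W w m) ≥ t / log t` costs a factor `log t`, paid for by `c < b`.
  have hpow : t ^ c ≤ log (W w m) ^ b := by
    have h7 : t ^ (c / b) ≤ t / log t := by
      rw [le_div_iff₀ (by linarith)]; linarith
    calc t ^ c = (t ^ (c / b)) ^ b := by
          rw [← rpow_mul t0.le]; congr 1; field_simp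
      _ ≤ _ := rpow_le_rpow (by positivity) (h7.trans hlogl) b0.le
  have wm := hw.pos m m0.le
  have wp := hw.pos p hp
  rcases le_total m p with hmp | hpm
  · refine le_trans (b := 1) ?_ ((one_le_div wm).2 (hw.monotoneOn m0.le hp hmp))
    rw [exp_le_one_iff]
    have := rpow_nonneg (hdiv.le.trans hlogl) b
    linarith
  obtain ⟨e', p0, pl⟩ := hx₀ p (h2.trans hp1)
  have h8 : p / w p ≤ m / w m := by
    rw [e, e']
    exact exp_le_exp.2 (div_log_le_div_log pl (log_le_log p0 hpm))
  calc exp (-(log (W w m)) ^ b) ≤ exp (-t ^ c) := by gcongr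
    _ ≤ p / m := by rw [le_div_iff₀ m0]; linarith
    _ ≤ w p / w m := by
      rw [div_le_div_iff₀ wp wm] at h8
      rw [div_le_div_iff₀ m0 wm]
      linarith

/-! ### The inverse of `W` and the operator `G` -/

theorem IsWeightFunction.tendsto_W (hw : IsWeightFunction w)
    (hlarge : ∀ᶠ x : ℝ in atTop, w x = x * exp (-(log x / log (log x)))) :
    Tendsto (W w) atTop atTop := by
  refine tendsto_atTop_mono' (f₁ := fun x => log (log x)) _ ?_
    (tendsto_log_atTop.comp tendsto_log_atTop)
  filter_upwards [eventually_div_weight hlarge, eventually_ge_atTop 0,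
    tendsto_log_atTop.eventually (eventually_mul_log_le one_half_pos 1),
    tendsto_log_atTop.eventually (eventually_gt_atTop (exp 1))] with x hx h0 h1 h2
  refine le_trans ?_ (hw.div_le_W h0)
  rw [hx]
  have t0 : 0 < log x := (exp_pos 1).trans h2
  have lt : 1 < log (log x) := by rwa [lt_log_iff_exp_lt t0]
  have h3 : log (log x) ≤ log x / log (log x) := by
    rw [le_div_iff₀ (by linarith)]
    have h4 : log x ^ (1 / 2 : ℝ) * log x ^ (1 / 2 : ℝ) = log x := by
      rw [← rpow_add t0]; norm_num
    calc log (log x) * log (log x) ≤ log x ^ (1 / 2 : ℝ) * log x ^ (1 / 2 : ℝ) := by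
          rw [one_mul] at h1; gcongr
      _ = log x := h4
  linarith [add_one_le_exp (log x / log (log x))]

theorem IsWeightFunction.surjOn_W (hw : IsWeightFunction w)
    (h : Tendsto (W w) atTop atTop) : SurjOn (W w) (Ici 0) (Ici 0) := by
  intro y hy
  obtain ⟨b, hb, hb0⟩ := ((h.eventually_ge_atTop y).and (eventually_ge_atTop 0)).exists
  obtain ⟨x, hx, rfl⟩ := intermediate_value_Icc hb0
    (hw.continuousOn_W.mono Icc_subset_Ici_self) (show y ∈ Icc (W w 0) (W w b) by
      rw [W_zero]; exact ⟨hy, hb⟩)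
  exact ⟨x, hx.1, rfl⟩

theorem IsWeightFunction.Winv_nonneg (hw : IsWeightFunction w)
    (h : Tendsto (W w) atTop atTop) {y : ℝ} (hy : 0 ≤ y) : 0 ≤ Winv w y :=
  Function.invFunOn_mem (hw.surjOn_W h hy)

theorem IsWeightFunction.W_Winv (hw : IsWeightFunction w)
    (h : Tendsto (W w) atTop atTop) {y : ℝ} (hy : 0 ≤ y) : W w (Winv w y) = y :=
  Function.invFunOn_eq (hw.surjOn_W h hy)

theorem IsWeightFunction.W_nonneg (hw : IsWeightFunction w) {x : ℝ} (hx : 0 ≤ x) :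
    0 ≤ W w x := by
  rw [← W_zero (w := w)]
  exact hw.strictMonoOn_W.monotoneOn (mem_Ici.2 le_rfl) hx hx

theorem IsWeightFunction.Winv_W (hw : IsWeightFunction w)
    (h : Tendsto (W w) atTop atTop) {x : ℝ} (hx : 0 ≤ x) : Winv w (W w x) = x :=
  hw.strictMonoOn_W.injOn (hw.Winv_nonneg h (hw.W_nonneg hx)) hx
    (hw.W_Winv h (hw.W_nonneg hx))

theorem IsWeightFunction.strictMonoOn_Winv (hw : IsWeightFunction w)
    (h : Tendsto (W w) atTop atTop) : StrictMonoOn (Winv w) (Ici 0) := by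
  intro x hx y hy hxy
  rwa [← hw.strictMonoOn_W.lt_iff_lt (hw.Winv_nonneg h hx) (hw.Winv_nonneg h hy),
    hw.W_Winv h hx, hw.W_Winv h hy]

theorem IsWeightFunction.continuousOn_Winv (hw : IsWeightFunction w)
    (h : Tendsto (W w) atTop atTop) : ContinuousOn (Winv w) (Ici 0) := by
  have hs := hw.strictMonoOn_Winv h
  have himg : Winv w '' Ici 0 = Ici 0 := by
    ext x
    constructor
    · rintro ⟨y, hy, rfl⟩
      exact hw.Winv_nonneg h hy
    · exact fun hx => ⟨W w x, hw.W_nonneg hx, hw.Winv_W h hx⟩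
  intro y hy
  rcases (mem_Ici.1 hy).eq_or_lt with rfl | h0
  · refine hs.continuousWithinAt_right_of_image_mem_nhdsWithin self_mem_nhdsWithin ?_
    rw [himg]
    refine mem_of_superset self_mem_nhdsWithin fun z hz => ?_
    exact (hw.Winv_nonneg h le_rfl).trans hz
  · refine (hs.continuousAt_of_image_mem_nhds (Ici_mem_nhds h0) ?_).continuousWithinAt
    rw [himg]
    exact Ici_mem_nhds ((hw.Winv_nonneg h le_rfl).trans_lt (hs (mem_Ici.2 le_rfl) hy h0))

theorem IsWeightFunction.tendsto_Winv (hw : IsWeightFunction w)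
    (h : Tendsto (W w) atTop atTop) : Tendsto (Winv w) atTop atTop := by
  rw [tendsto_atTop]
  intro c
  filter_upwards [eventually_ge_atTop (W w (max c 0))] with y hy
  have h1 := (hw.strictMonoOn_Winv h).monotoneOn (hw.W_nonneg (le_max_right c 0))
    ((hw.W_nonneg (le_max_right c 0)).trans hy) hy
  rw [hw.Winv_W h (le_max_right c 0)] at h1
  exact (le_max_left c 0).trans h1

theorem IsWeightFunction.continuousOn_G_integrand (hw : IsWeightFunction w)
    (h : Tendsto (W w) atTop atTop) (hf : ContinuousOn f (Ici 0)) (hf0 : ∀ x, 0 ≤ x → 0 ≤ f x) :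
    ContinuousOn (fun u => w (Winv w (f u)) / w (Winv w u)) (Ici 0) := by
  have h1 : ContinuousOn (fun u => w (Winv w u)) (Ici 0) :=
    hw.continuousOn.comp (hw.continuousOn_Winv h) fun u hu => hw.Winv_nonneg h hu
  exact (h1.comp hf hf0).div h1 fun u hu => (hw.pos _ (hw.Winv_nonneg h hu)).ne'

theorem IsWeightFunction.G_integrand_nonneg (hw : IsWeightFunction w)
    (h : Tendsto (W w) atTop atTop) (hf0 : ∀ x, 0 ≤ x → 0 ≤ f x) {u : ℝ} (hu : 0 ≤ u) :
    0 ≤ w (Winv w (f u)) / w (Winv w u) :=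
  div_nonneg (hw.pos _ (hw.Winv_nonneg h (hf0 u hu))).le (hw.pos _ (hw.Winv_nonneg h hu)).le

/-- A continuous function `[0,∞) → [0,∞)` that is eventually at least `x exp (-(log x)^b)`, for some
exponent `b ∈ (0,1)`. -/
structure AlmostLinear (f : ℝ → ℝ) : Prop where
  continuousOn : ContinuousOn f (Ici 0)
  nonneg : ∀ x, 0 ≤ x → 0 ≤ f x
  lower : ∃ b : ℝ, 0 < b ∧ b < 1 ∧ ∀ᶠ x : ℝ in atTop, x * exp (-(log x) ^ b) ≤ f x

theorem AlmostLinear.not_bounded (hf : AlmostLinear f) :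
    ¬ ∃ C : ℝ, ∀ x, 0 ≤ x → |f x| ≤ C := by
  rintro ⟨C, hC⟩
  obtain ⟨b, -, hb, h⟩ := hf.lower
  obtain ⟨x, h1, h2, h3⟩ := (h.and (((tendsto_mul_exp_neg_log_rpow hb).eventually_gt_atTop
    C).and (eventually_ge_atTop 0))).exists
  linarith [hC x h3, le_abs_self (f x)]

theorem eventually_exp_neg_rpow_le {a b c : ℝ} (ha : 0 < a) (hab : a < b) (hc : 0 < c) :
    ∀ᶠ x : ℝ in atTop, exp (-(log x) ^ b) ≤ c * exp (-(log x) ^ a) := by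
  filter_upwards [tendsto_log_atTop.eventually (eventually_mul_rpow_le hab 2),
    tendsto_log_atTop.eventually (eventually_mul_rpow_le ha (-log c))] with x h1 h2
  rw [rpow_zero] at h2
  rw [← exp_log hc, ← exp_add, exp_le_exp]
  linarith

theorem almostLinear_const_mul {c : ℝ} (hc : 0 < c) : AlmostLinear fun u => c * u := by
  refine ⟨by fun_prop, fun x hx => by positivity, 1 / 2, by norm_num, by norm_num, ?_⟩
  filter_upwards [eventually_exp_neg_rpow_le (a := 1 / 4) (b := 1 / 2) (by norm_num)
    (by norm_num) hc, eventually_ge_atTop 1] with x hx h1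
  rw [mul_comm]
  gcongr
  refine hx.trans (mul_le_of_le_one_right hc.le ?_)
  rw [exp_le_one_iff]
  have := rpow_nonneg (log_nonneg h1) (1 / 4)
  linarith

/-- On `[x₀, x]` the integrand is at least `exp (-(log x)^b)`, and this interval has length at least
`x / 2`. Raising the exponent to `c > b` absorbs the factor `1 / 2`. -/
theorem AlmostLinear.G (hf : AlmostLinear f) (hw : IsWeightFunction w)
    (hlarge : ∀ᶠ x : ℝ in atTop, w x = x * exp (-(log x / log (log x)))) :
    AlmostLinear (G w f) := by
  have hW := hw.tendsto_W hlarge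
  have hcont := hw.continuousOn_G_integrand hW hf.continuousOn hf.nonneg
  have hint : ∀ {x y : ℝ}, 0 ≤ x → 0 ≤ y → IntervalIntegrable
      (fun u => w (Winv w (f u)) / w (Winv w u)) volume x y := fun hx hy =>
    (hcont.mono fun _ hz => (le_min hx hy).trans hz.1).intervalIntegrable
  refine ⟨?_, fun x hx => ?_, ?_⟩
  · intro x hx
    have hx0 : (0 : ℝ) ≤ x := hx
    have h := intervalIntegral.continuousOn_primitive_interval (a := 0) (b := x + 1)
      (f := fun u => w (Winv w (f u)) / w (Winv w u)) (μ := volume) (by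
        rw [uIcc_of_le (by linarith)]
        exact (hcont.mono Icc_subset_Ici_self).integrableOn_Icc)
    rw [uIcc_of_le (by linarith)] at h
    refine (h x ⟨hx0, by linarith⟩).mono_of_mem_nhdsWithin ?_
    exact mem_nhdsWithin.2 ⟨Iio (x + 1), isOpen_Iio, by simp, fun y hy => ⟨hy.2, hy.1.le⟩⟩
  · exact intervalIntegral.integral_nonneg hx fun u hu =>
      hw.G_integrand_nonneg hW hf.nonneg hu.1
  · obtain ⟨a, a0, a1, h⟩ := hf.lower
    obtain ⟨b, hab, b1⟩ := exists_between a1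
    obtain ⟨c, hbc, c1⟩ := exists_between b1
    have b0 := a0.trans hab
    obtain ⟨x₀, hx₀⟩ := eventually_atTop.1 ((h.and ((hw.tendsto_Winv hW).eventually
      (hw.eventually_weight_ratio hlarge a0 hab b1))).and (eventually_ge_atTop 1))
    have x0 : 1 ≤ x₀ := (hx₀ x₀ le_rfl).2
    refine ⟨c, b0.trans hbc, c1, ?_⟩
    filter_upwards [eventually_exp_neg_rpow_le b0 hbc one_half_pos,
      eventually_ge_atTop (2 * x₀)] with x h1 h2
    have hx : 0 ≤ x := by linarith
    have h3 : ∫ _ in x₀..x, exp (-(log x) ^ b) ≤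
        ∫ u in x₀..x, w (Winv w (f u)) / w (Winv w u) := by
      refine intervalIntegral.integral_mono_on (by linarith) (by simp)
        (hint (by linarith) hx) fun u hu => ?_
      obtain ⟨⟨h4, h5⟩, h6⟩ := hx₀ u hu.1
      have hu0 : 0 ≤ u := by linarith
      rw [hw.W_Winv hW hu0] at h5
      refine le_trans ?_ (h5 _ (hw.Winv_nonneg hW (hf.nonneg u hu0)) ?_)
      · rw [exp_le_exp, neg_le_neg_iff]
        exact rpow_le_rpow (log_nonneg h6) (log_le_log (by linarith) hu.2) b0.le
      · rwa [hw.W_Winv hW (hf.nonneg u hu0)]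
    have h4 : 0 ≤ ∫ u in (0 : ℝ)..x₀, w (Winv w (f u)) / w (Winv w u) :=
      intervalIntegral.integral_nonneg (by linarith) fun u hu =>
        hw.G_integrand_nonneg hW hf.nonneg hu.1
    have h5 := intervalIntegral.integral_add_adjacent_intervals
      (hint le_rfl (by linarith : 0 ≤ x₀)) (hint (by linarith : 0 ≤ x₀) hx)
    rw [intervalIntegral.integral_const, smul_eq_mul] at h3
    calc x * exp (-(log x) ^ c) ≤ x * (1 / 2 * exp (-(log x) ^ b)) := by gcongr
      _ = (x / 2) * exp (-(log x) ^ b) := by ring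
      _ ≤ (x - x₀) * exp (-(log x) ^ b) := by gcongr; linarith
      _ ≤ VRRW.G w f x := by rw [VRRW.G, ← h5]; linarith

theorem AlmostLinear.iterate_G (hf : AlmostLinear f) (hw : IsWeightFunction w)
    (hlarge : ∀ᶠ x : ℝ in atTop, w x = x * exp (-(log x / log (log x)))) (n : ℕ) :
    AlmostLinear ((VRRW.G w)^[n] f) := by
  induction n with
  | zero => exact hf
  | succ n ih => rw [Function.iterate_succ_apply']; exact ih.G hw hlarge

theorem IsWeightFunction.index_eq_top (hw : IsWeightFunction w)
    (hlarge : ∀ᶠ x : ℝ in atTop, w x = x * exp (-(log x / log (log x)))) {η : ℝ} (hη : 0 < η) :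
    index w η = ⊤ := by
  rw [index, sInf_eq_top]
  rintro _ ⟨n, ⟨-, hn⟩, rfl⟩
  exact absurd hn ((almostLinear_const_mul hη).iterate_G hw hlarge _).not_bounded

theorem isLittleO_weight
    (hlarge : ∀ᶠ x : ℝ in atTop, w x = x * exp (-(log x / log (log x)))) {α : ℝ} (hα : α < 1) :
    w =o[atTop] fun x : ℝ => x / exp ((log x) ^ α) := by
  -- `α` may be negative, whereas `β > 0` is needed for `exp (-(log x)^β)` to tend to 0.
  obtain ⟨β, hβ, hβ1⟩ := exists_between (max_lt hα one_pos)
  obtain ⟨hαβ, hβ0⟩ := max_lt_iff.1 hβ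
  refine (isLittleO_of_tendsto' ?_ ?_)
  · filter_upwards [eventually_gt_atTop 0] with x hx h
    have := div_pos hx (exp_pos (log x ^ α))
    linarith
  refine squeeze_zero' (g := fun x => exp (-(log x ^ β))) ?_ ?_ ?_
  · filter_upwards [hlarge, eventually_gt_atTop 0] with x hx h0
    rw [hx]; positivity
  · filter_upwards [hlarge, eventually_gt_atTop 0,
      tendsto_log_atTop.eventually (eventually_mul_rpow_mul_log_le hβ1 2),
      tendsto_log_atTop.eventually (eventually_mul_rpow_le hαβ 1),
      tendsto_log_atTop.eventually (eventually_gt_atTop 1)] with x hx h0 h1 h2 h3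
    have : w x / (x / exp (log x ^ α)) = exp (-(log x / log (log x)) + log x ^ α) := by
      rw [hx, exp_add]; field_simp
    rw [this, exp_le_exp]
    rw [rpow_one, ← le_div_iff₀ (log_pos h3)] at h1
    linarith
  · exact tendsto_exp_atBot.comp (tendsto_neg_atTop_atBot.comp
      ((tendsto_rpow_atTop hβ0).comp tendsto_log_atTop))

end AlmostLinear
-- An exponential supermartingale attached to each site.
section Energy

theorem visits_congr {x x' : ℕ → ℤ} {n : ℕ} (h : ∀ i ≤ n, x i = x' i) (y : ℤ) :
    visits x n y = visits x' n y := by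
  rw [visits, visits]
  congr 1
  refine Finset.filter_congr fun i hi => ?_
  rw [h i (Nat.lt_succ_iff.1 (Finset.mem_range.1 hi))]

theorem visits_succ (x : ℕ → ℤ) (n : ℕ) (y : ℤ) :
    visits x (n + 1) y = visits x n y + if x (n + 1) = y then 1 else 0 := by
  simp only [visits, Finset.card_filter]
  rw [Finset.sum_range_succ]

theorem visits_le (x : ℕ → ℤ) (n : ℕ) (y : ℤ) : visits x n y ≤ n + 1 := by
  simpa [visits] using Finset.card_filter_le (Finset.range (n + 1)) fun i => x i = y

/-- The compensator, up to time `n`, of the sum of the inverse weights of `y + 1` at the jumps of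
the path from `y` to `y + 1`. -/
noncomputable def drift (w : ℕ → ℝ) (x : ℕ → ℤ) (y : ℤ) (n : ℕ) : ℝ :=
  ∑ k ∈ Finset.range n,
    if x k = y then 1 / (w (visits x k (y - 1)) + w (visits x k (y + 1))) else 0

/-- The sum of the first `z` inverse weights. -/
noncomputable def invSum (w : ℕ → ℝ) (z : ℕ) : ℝ := ∑ j ∈ Finset.range z, 1 / w j

/-- A functional of the path whose expectation does not increase along the walk. -/
noncomputable def energy (w : ℕ → ℝ) (x : ℕ → ℤ) (y : ℤ) (n : ℕ) : ℝ :=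
  exp (w 0 / 2 * drift w x y n - w 0 * invSum w (visits x n (y + 1)))

theorem energy_pos (w : ℕ → ℝ) (x : ℕ → ℤ) (y : ℤ) (n : ℕ) : 0 < energy w x y n := exp_pos _

theorem energy_congr (w : ℕ → ℝ) {x x' : ℕ → ℤ} {n : ℕ} (h : ∀ i ≤ n, x i = x' i) (y : ℤ) :
    energy w x y n = energy w x' y n := by
  have hd : drift w x y n = drift w x' y n := by
    refine Finset.sum_congr rfl fun k hk => ?_
    have hk' := (Finset.mem_range.1 hk).le
    rw [h k hk', visits_congr fun i hi => h i (hi.trans hk'),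
      visits_congr fun i hi => h i (hi.trans hk')]
  rw [energy, energy, hd, visits_congr h]

variable {w : ℕ → ℝ}

theorem energy_zero_le_one (hw : ∀ n, 0 < w n) (x : ℕ → ℤ) (y : ℤ) : energy w x y 0 ≤ 1 := by
  rw [energy, exp_le_one_iff]
  have h : 0 ≤ invSum w (visits x 0 (y + 1)) :=
    Finset.sum_nonneg fun j _ => (one_div_pos.2 (hw j)).le
  simpa [drift] using mul_nonneg (hw 0).le h

theorem energy_succ (x : ℕ → ℤ) (y : ℤ) (n : ℕ) :
    energy w x y (n + 1) = energy w x y n *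
      (exp (w 0 / 2 * if x n = y then
          1 / (w (visits x n (y - 1)) + w (visits x n (y + 1))) else 0) *
        exp (-(w 0 * if x (n + 1) = y + 1 then 1 / w (visits x n (y + 1)) else 0))) := by
  have h1 : invSum w (visits x (n + 1) (y + 1)) = invSum w (visits x n (y + 1)) +
      if x (n + 1) = y + 1 then 1 / w (visits x n (y + 1)) else 0 := by
    rw [visits_succ]
    split_ifs
    · rw [invSum, Finset.sum_range_succ, invSum]
    · simp
  rw [energy, energy, ← exp_add, ← exp_add, h1, drift, Finset.sum_range_succ, ← drift]
  congr 1
  ring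

/-- One step of the walk from `y`: `p` is the probability of a jump to the right, `p * t` the growth
of the drift term, and `2 * t` the loss if the jump occurs. The restriction on `t` gives `(1 - t) *
(1 + 2 * t) ≥ 1`. -/
theorem exp_mul_average_le_one {p t : ℝ} (hp : 0 ≤ p) (ht : 0 ≤ t) (ht' : t ≤ 1 / 2) :
    exp (p * t) * (p * exp (-(2 * t)) + (1 - p)) ≤ 1 := by
  have h1 : exp (-(2 * t)) ≤ 1 - t := by
    rw [exp_neg, inv_le_comm₀ (exp_pos _) (by linarith)]
    refine le_trans ?_ (add_one_le_exp (2 * t))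
    rw [inv_le_iff_one_le_mul₀ (by linarith)]
    nlinarith
  have h2 : p * exp (-(2 * t)) + (1 - p) ≤ exp (-(p * t)) := by
    have := add_one_le_exp (-(p * t))
    nlinarith [mul_le_mul_of_nonneg_left h1 hp]
  calc _ ≤ exp (p * t) * exp (-(p * t)) := by gcongr
    _ = 1 := by rw [← exp_add, add_neg_cancel, exp_zero]

variable {Ω : Type*} [MeasurableSpace Ω] {X : ℕ → Ω → ℤ} {μ : Measure Ω}

theorem measurable_visits (hX : ∀ n, Measurable (X n)) (n : ℕ) (y : ℤ) :
    Measurable fun ω => visits (fun k => X k ω) n y := by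
  simp only [visits, Finset.card_filter]
  exact Finset.measurable_sum _ fun i _ =>
    Measurable.ite (hX i (measurableSet_singleton y)) measurable_const measurable_const

theorem measurable_energy (hX : ∀ n, Measurable (X n)) (n : ℕ) (y : ℤ) :
    Measurable fun ω => energy w (fun k => X k ω) y n := by
  have hw : Measurable w := measurable_from_top
  have hs : Measurable (invSum w) := measurable_from_top
  refine (((Finset.measurable_sum _ fun k _ => ?_).const_mul _).sub
    ((hs.comp (measurable_visits hX n (y + 1))).const_mul _)).exp
  refine Measurable.ite (hX k (measurableSet_singleton y)) ?_ measurable_const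
  exact measurable_const.div ((hw.comp (measurable_visits hX k (y - 1))).add
    (hw.comp (measurable_visits hX k (y + 1))))

theorem measurableSet_history (hX : ∀ n, Measurable (X n)) (x : ℕ → ℤ) (n : ℕ) :
    MeasurableSet (history X x n) := by
  have : history X x n = ⋂ i, ⋂ (_ : i ≤ n), X i ⁻¹' {x i} := by
    ext ω; simp [history]
  rw [this]
  exact MeasurableSet.iInter fun i => MeasurableSet.iInter fun _ =>
    hX i (measurableSet_singleton _)

/-- Away from `y` the drift is frozen, and an arrival at `y + 1` from the other side only lowers the
energy. At `y` the past is fixed on `history`, so only the next jump matters; `w 0 ≤ w n` keeps `t ≤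
1 / 2`. -/
theorem IsVRRW.setLIntegral_energy_succ_le [IsProbabilityMeasure μ] (hX : IsVRRW w X μ)
    (hw : ∀ n, 0 < w n) (hw0 : ∀ n, w 0 ≤ w n) (y : ℤ) (n : ℕ) (x : ℕ → ℤ) :
    ∫⁻ ω in history X x n, ENNReal.ofReal (energy w (fun k => X k ω) y (n + 1)) ∂μ ≤
      ∫⁻ ω in history X x n, ENNReal.ofReal (energy w (fun k => X k ω) y n) ∂μ := by
  have hS := measurableSet_history hX.measurable x n
  by_cases hy : x n = y
  swap
  · refine setLIntegral_mono' hS fun ω hω => ENNReal.ofReal_le_ofReal ?_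
    have hn : X n ω ≠ y := by rwa [hω n le_rfl]
    rw [energy_succ, if_neg hn, mul_zero, exp_zero, one_mul]
    refine mul_le_of_le_one_right (energy_pos _ _ _ _).le ?_
    rw [exp_le_one_iff, neg_nonpos]
    have h1 := hw 0
    have h2 := hw (visits (fun k => X k ω) n (y + 1))
    split_ifs <;> positivity
  rcases eq_or_ne (μ (history X x n)) 0 with h0 | h0
  · rw [Measure.restrict_eq_zero.2 h0, lintegral_zero_measure, lintegral_zero_measure]
  subst hy
  set S := history X x n
  set R := {ω | X (n + 1) ω = x n + 1}
  have hR : MeasurableSet R := hX.measurable (n + 1) (measurableSet_singleton _)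
  set v := energy w x (x n) n
  set l := w (visits x n (x n - 1))
  set r := w (visits x n (x n + 1))
  have hl : 0 < l := hw _
  have hr : 0 < r := hw _
  have hw00 := hw 0
  have hv : 0 < v := energy_pos _ _ _ _
  set p := r / (l + r)
  have hp0 : 0 ≤ p := by positivity
  have hp1 : p ≤ 1 := by rw [div_le_one (by positivity)]; linarith
  set t := w 0 / 2 * (1 / r)
  have ht0 : 0 ≤ t := by positivity
  have ht1 : t ≤ 1 / 2 := by
    have : w 0 / r ≤ 1 := (div_le_one hr).2 (hw0 _)
    calc t = w 0 / r / 2 := by simp only [t]; ring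
      _ ≤ _ := by linarith
  have hpt : p * t = w 0 / 2 * (1 / (l + r)) := by
    simp only [p, t]
    field_simp
  have hpath : ∀ ω ∈ S, ∀ i ≤ n, X i ω = x i := fun ω hω => hω
  have hE : ∀ ω ∈ S, energy w (fun k => X k ω) (x n) (n + 1) = v * (exp (p * t) *
      exp (-(w 0 * if X (n + 1) ω = x n + 1 then 1 / r else 0))) := by
    intro ω hω
    have hωp := hpath ω hω
    rw [energy_succ, energy_congr w hωp, visits_congr hωp, visits_congr hωp, hωp n le_rfl,
      if_pos rfl, hpt]
  have := cond_isProbabilityMeasure h0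
  have hright : μ[R | S] = ENNReal.ofReal p := hX.right n x h0
  have h1 : μ (S ∩ R) = ENNReal.ofReal p * μ S := by
    rw [← hright, cond_mul_eq_inter hS]
  have h2 : μ (S \ R) = ENNReal.ofReal (1 - p) * μ S := by
    rw [sdiff_eq, ← cond_mul_eq_inter hS, prob_compl_eq_one_sub hR, hright,
      ENNReal.ofReal_sub _ hp0, ENNReal.ofReal_one]
  have hn : ∫⁻ ω in S, ENNReal.ofReal (energy w (fun k => X k ω) (x n) n) ∂μ =
      ENNReal.ofReal v * μ S := by
    rw [← setLIntegral_const]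
    exact setLIntegral_congr_fun hS fun ω hω => by rw [energy_congr w (hpath ω hω)]
  have i1 : ∫⁻ ω in S ∩ R, ENNReal.ofReal (energy w (fun k => X k ω) (x n) (n + 1)) ∂μ =
      ENNReal.ofReal (v * (exp (p * t) * exp (-(2 * t)))) * μ (S ∩ R) := by
    rw [← setLIntegral_const]
    refine setLIntegral_congr_fun (hS.inter hR) fun ω hω => ?_
    have hωR : X (n + 1) ω = x n + 1 := hω.2
    rw [hE ω hω.1, if_pos hωR]
    congr 5
    simp only [t]
    ring
  have i2 : ∫⁻ ω in S \ R, ENNReal.ofReal (energy w (fun k => X k ω) (x n) (n + 1)) ∂μ =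
      ENNReal.ofReal (v * exp (p * t)) * μ (S \ R) := by
    rw [← setLIntegral_const]
    refine setLIntegral_congr_fun (hS.diff hR) fun ω hω => ?_
    have hωR : ¬ X (n + 1) ω = x n + 1 := hω.2
    rw [hE ω hω.1, if_neg hωR, mul_zero, neg_zero, exp_zero, mul_one]
  rw [← lintegral_inter_add_sdiff _ S hR, i1, i2, hn, h1, h2, ← mul_assoc,
    ← mul_assoc (ENNReal.ofReal (v * exp (p * t))), ← add_mul,
    ← ENNReal.ofReal_mul (by positivity), ← ENNReal.ofReal_mul (by positivity),
    ← ENNReal.ofReal_add (by positivity)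
      (mul_nonneg (by positivity) (sub_nonneg.2 hp1))]
  gcongr
  calc v * (exp (p * t) * exp (-(2 * t))) * p + v * exp (p * t) * (1 - p)
      = v * (exp (p * t) * (p * exp (-(2 * t)) + (1 - p))) := by ring
    _ ≤ v := mul_le_of_le_one_right hv.le (exp_mul_average_le_one hp0 ht0 ht1)

theorem IsVRRW.lintegral_energy_le_one [IsProbabilityMeasure μ] (hX : IsVRRW w X μ)
    (hw : ∀ n, 0 < w n) (hw0 : ∀ n, w 0 ≤ w n) (y : ℤ) (n : ℕ) :
    ∫⁻ ω, ENNReal.ofReal (energy w (fun k => X k ω) y n) ∂μ ≤ 1 := by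
  induction n with
  | zero =>
    calc _ ≤ ∫⁻ _, 1 ∂μ := lintegral_mono fun ω => by
          rw [← ENNReal.ofReal_one]
          exact ENNReal.ofReal_le_ofReal (energy_zero_le_one hw _ y)
      _ = 1 := by simp
  | succ n ih =>
    refine le_trans ?_ ih
    -- The value 0 after time `n` is immaterial: `history` reads the path up to `n` only. This gives
    -- a countable partition of the space.
    let ext : (Fin (n + 1) → ℤ) → ℕ → ℤ := fun h i => if hi : i ≤ n then h ⟨i, Nat.lt_succ_of_le hi⟩ else 0
    have hU : ⋃ h, history X (ext h) n = univ := by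
      refine eq_univ_of_forall fun ω => mem_iUnion.2 ⟨fun i => X i ω, fun i hi => ?_⟩
      simp [ext, hi]
    have hd : Pairwise (Function.onFun Disjoint fun h => history X (ext h) n) := by
      intro h h' hne
      refine Set.disjoint_left.2 fun ω h1 h2 => hne (funext fun i => ?_)
      have e := (h1 i (Nat.lt_succ_iff.1 i.2)).symm.trans (h2 i (Nat.lt_succ_iff.1 i.2))
      simpa [ext, Nat.lt_succ_iff.1 i.2] using e
    rw [← setLIntegral_univ, ← hU,
      lintegral_iUnion (fun h => measurableSet_history hX.measurable _ n) hd, ← setLIntegral_univ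
        (μ := μ) fun ω => ENNReal.ofReal (energy w (fun k => X k ω) y n), ← hU,
      lintegral_iUnion (fun h => measurableSet_history hX.measurable _ n) hd]
    exact ENNReal.tsum_le_tsum fun h => hX.setLIntegral_energy_succ_le hw hw0 y n (ext h)

/-- Fatou's lemma is applied to the sum over `I`, so that the same times serve all the sites. -/
theorem IsVRRW.ae_frequently_energy_le [IsProbabilityMeasure μ] (hX : IsVRRW w X μ)
    (hw : ∀ n, 0 < w n) (hw0 : ∀ n, w 0 ≤ w n) (I : Finset ℤ) :
    ∀ᵐ ω ∂μ, ∃ K : ℝ, ∃ᶠ n in atTop, ∀ y ∈ I, energy w (fun k => X k ω) y n ≤ K := by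
  set F : ℕ → Ω → ENNReal := fun n ω =>
    ∑ y ∈ I, ENNReal.ofReal (energy w (fun k => X k ω) y n)
  have hF : ∀ n, Measurable (F n) := fun n =>
    Finset.measurable_sum _ fun y _ => (measurable_energy hX.measurable n y).ennreal_ofReal
  have hle : ∀ n, ∫⁻ ω, F n ω ∂μ ≤ I.card := by
    intro n
    rw [lintegral_finsetSum _ fun y _ => (measurable_energy hX.measurable n y).ennreal_ofReal]
    refine (Finset.sum_le_sum fun y _ => hX.lintegral_energy_le_one hw hw0 y n).trans ?_
    simp
  have hlim : ∫⁻ ω, liminf (fun n => F n ω) atTop ∂μ ≠ ⊤ := by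
    refine ne_top_of_le_ne_top (ENNReal.natCast_ne_top I.card)
      ((lintegral_liminf_le hF).trans ?_)
    exact (liminf_le_liminf (Eventually.of_forall hle)).trans_eq (liminf_const _)
  filter_upwards [ae_lt_top (Measurable.liminf hF) hlim] with ω hω
  obtain ⟨K, hK1, hK2⟩ := exists_between hω
  refine ⟨K.toReal, (frequently_lt_of_liminf_lt (by isBoundedDefault) hK1).mono
    fun n hn y hy => ?_⟩
  rw [← ENNReal.ofReal_le_iff_le_toReal hK2.ne]
  exact (Finset.single_le_sum (f := fun y => ENNReal.ofReal (energy w (fun k => X k ω) y n))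
    (fun _ _ => zero_le) hy).trans hn.le

end Energy
-- Propagation of visits to the right and absence of localization.
section Localization

variable {w : ℝ → ℝ}

theorem IsWeightFunction.monotone_natCast (hw : IsWeightFunction w) :
    Monotone fun n : ℕ => w n := fun m n hmn =>
  hw.monotoneOn (mem_Ici.2 m.cast_nonneg) (mem_Ici.2 n.cast_nonneg) (Nat.cast_le.2 hmn)

theorem IsWeightFunction.zero_le_natCast (hw : IsWeightFunction w) (n : ℕ) : w 0 ≤ w n := by
  simpa using hw.monotone_natCast n.zero_le

theorem IsWeightFunction.invSum_le (hw : IsWeightFunction w) (z : ℕ) :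
    invSum (fun n => w n) z ≤ 1 / w 0 + W w z := by
  have h : ∀ z : ℕ, invSum (fun n => w n) (z + 1) ≤ 1 / w 0 + W w z := by
    intro z
    induction z with
    | zero => simp [invSum, W_zero]
    | succ z ih =>
      rw [invSum, Finset.sum_range_succ, ← invSum]
      have h1 := hw.sub_div_le_integral (a := (z : ℝ)) (b := ((z + 1 : ℕ) : ℝ))
        z.cast_nonneg (by simp)
      have h2 := hw.W_add_integral (a := (z : ℝ)) (b := ((z + 1 : ℕ) : ℝ))
        z.cast_nonneg (Nat.cast_nonneg _)
      have h3 : ((z + 1 : ℕ) : ℝ) - z = 1 := by push_cast; ring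
      rw [h3] at h1
      linarith
  refine le_trans ?_ (h z)
  exact Finset.sum_le_sum_of_subset_of_nonneg (Finset.range_mono z.le_succ)
    fun j _ _ => (one_div_pos.2 (hw.pos _ j.cast_nonneg)).le

/-- Each weight met before time `n` is at most `w n`. The `- 1` accounts for a visit at time `n`
itself, which the drift omits. -/
theorem IsWeightFunction.visits_sub_one_div_le_drift (hw : IsWeightFunction w) (x : ℕ → ℤ)
    (y : ℤ) (n : ℕ) :
    ((visits x n y : ℝ) - 1) / (2 * w n) ≤ drift (fun n => w n) x y n := by
  have hn := hw.pos n n.cast_nonneg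
  have hv : ∀ k < n, ∀ z, w (visits x k z) ≤ w n := fun k hk z =>
    hw.monotone_natCast ((visits_le x k z).trans hk)
  have h1 : (∑ k ∈ Finset.range n, if x k = y then 1 / (2 * w n) else 0) ≤
      drift (fun n => w n) x y n := by
    refine Finset.sum_le_sum fun k hk => ?_
    have hk' := Finset.mem_range.1 hk
    split_ifs
    · have h2 := hw.pos (visits x k (y - 1)) (Nat.cast_nonneg _)
      have h3 := hw.pos (visits x k (y + 1)) (Nat.cast_nonneg _)
      refine one_div_le_one_div_of_le (by positivity) ?_
      linarith [hv k hk' (y - 1), hv k hk' (y + 1)]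
    · exact le_rfl
  refine le_trans ?_ h1
  have h4 : visits x n y ≤ (∑ k ∈ Finset.range n, if x k = y then 1 else 0) + 1 := by
    rw [visits, Finset.card_filter, Finset.sum_range_succ]
    gcongr
    split_ifs <;> simp
  have h5 : (∑ k ∈ Finset.range n, if x k = y then 1 / (2 * w n) else 0) =
      ((∑ k ∈ Finset.range n, if x k = y then 1 else 0 : ℕ) : ℝ) / (2 * w n) := by
    push_cast
    rw [Finset.sum_div]
    refine Finset.sum_congr rfl fun k _ => ?_
    split_ifs <;> simp
  rw [h5]
  have h6 : (visits x n y : ℝ) ≤ (∑ k ∈ Finset.range n, if x k = y then 1 else 0 : ℕ) + 1 := by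
    exact_mod_cast h4
  gcongr
  linarith

theorem IsWeightFunction.visits_div_le_of_energy_le (hw : IsWeightFunction w) {K : ℝ} :
    ∃ C, ∀ (x : ℕ → ℤ) (y : ℤ) (n : ℕ), energy (fun n => w n) x y n ≤ K →
      (visits x n y : ℝ) / w n ≤ 4 * W w (visits x n (y + 1)) + C := by
  have h0 := hw.pos 0 le_rfl
  -- The factor 4 combines the `1 / 2` in the energy with the two neighbours in the drift. In `5 / w
  -- 0`, four parts come from `invSum_le` and one from the visit at time `n`.
  refine ⟨4 * log K / w 0 + 5 / w 0, fun x y n hE => ?_⟩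
  have hn := hw.pos n n.cast_nonneg
  rw [energy, ← le_log_iff_exp_le ((exp_pos _).trans_le hE)] at hE
  simp only [Nat.cast_zero] at hE
  have h1 := hw.visits_sub_one_div_le_drift x y n
  have h2 := hw.invSum_le (visits x n (y + 1))
  set D := drift (fun n => w n) x y n
  set S := invSum (fun n => w n) (visits x n (y + 1))
  have h3 : D ≤ 2 * S + 2 * log K / w 0 := by
    have : 2 * S + 2 * log K / w 0 = (2 * S * w 0 + 2 * log K) / w 0 := by field_simp
    rw [this, le_div_iff₀ h0]
    linarith
  have h4 : ((visits x n y : ℝ) - 1) / (2 * w n) = ((visits x n y : ℝ) / w n - 1 / w n) / 2 := by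
    field_simp
  have h5 : 1 / w n ≤ 1 / w 0 :=
    one_div_le_one_div_of_le h0 (hw.zero_le_natCast n)
  have h6 : 4 * log K / w 0 = 2 * (2 * log K / w 0) := by ring
  have h7 : 5 / w 0 = 5 * (1 / w 0) := by ring
  rw [h6, h7]
  linarith

/-- Since `m / w m` outgrows `exp ((log m)^a)`, the constant `C` is at most half of `z / w m`; so `W
w p ≥ z / (8 w m)`, and the `1 / 8` is absorbed by a larger exponent. -/
theorem IsWeightFunction.eventually_le_of_div_le (hw : IsWeightFunction w)
    (hlarge : ∀ᶠ x : ℝ in atTop, w x = x * exp (-(log x / log (log x)))) {a b : ℝ}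
    (ha : 0 < a) (hab : a < b) (hb : b < 1) (C : ℝ) :
    ∀ᶠ m in atTop, ∀ z p, 0 ≤ p → m * exp (-(log m) ^ a) ≤ z → z / w m ≤ 4 * W w p + C →
      m * exp (-(log m) ^ b) ≤ p := by
  obtain ⟨c, hac, hcb⟩ := exists_between hab
  filter_upwards [hw.eventually_le_of_le_W hlarge (ha.trans hac) hcb (hcb.trans hb),
    eventually_exp_neg_rpow_le ha hac (by norm_num : (0 : ℝ) < 1 / 8),
    eventually_div_weight hlarge, eventually_gt_atTop 0,
    tendsto_log_atTop.eventually (eventually_mul_rpow_mul_log_le (hac.trans (hcb.trans hb)) 2),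
    tendsto_log_atTop.eventually (eventually_mul_rpow_le ha (2 * C)),
    tendsto_log_atTop.eventually (eventually_gt_atTop 1)] with m h1 h2 h3 h4 h5 h6 h7
  intro z p hp hz hC
  refine h1 p hp ?_
  have hm := hw.pos m h4.le
  rw [rpow_one, ← le_div_iff₀ (log_pos h7)] at h5
  rw [rpow_zero, mul_one] at h6
  have h8 : 2 * C ≤ m / w m * exp (-(log m) ^ a) := by
    rw [h3, ← exp_add]
    linarith [add_one_le_exp (log m / log (log m) + -log m ^ a)]
  have h9 : m / w m * exp (-(log m) ^ a) ≤ z / w m := by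
    rw [div_mul_eq_mul_div]
    gcongr
  have h10 : m / w m * exp (-(log m) ^ c) ≤ m / w m * (1 / 8 * exp (-(log m) ^ a)) := by
    gcongr
  linarith

theorem sum_visits (x : ℕ → ℤ) (I : Finset ℤ) (hx : ∀ n, x n ∈ I) (n : ℕ) :
    ∑ y ∈ I, visits x n y = n + 1 := by
  rw [← Finset.card_range (n + 1)]
  exact (Finset.card_eq_sum_card_fiberwise fun i _ => hx i).symm

theorem IsWeightFunction.not_frequently_energy_le (hw : IsWeightFunction w)
    (hlarge : ∀ᶠ x : ℝ in atTop, w x = x * exp (-(log x / log (log x)))) {x : ℕ → ℤ} {N : ℕ}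
    (hx : ∀ n, x n ∈ Finset.Icc (-N : ℤ) N) (K : ℝ) :
    ¬ ∃ᶠ n in atTop, ∀ y ∈ Finset.Icc (-N : ℤ) N, energy (fun n => w n) x y n ≤ K := by
  obtain ⟨C, hC⟩ := hw.visits_div_le_of_energy_le (K := K)
  have hzero : ∀ n y, y ∉ Finset.Icc (-N : ℤ) N → visits x n y = 0 := by
    intro n y hy
    rw [visits, Finset.card_eq_zero, Finset.filter_eq_empty_iff]
    rintro i - rfl
    exact hy (hx i)
  -- The exponent may depend on `j`: it grows at each step to the right but stays below 1. The case
  -- `j = 0` is the pigeonhole principle on `2N + 1` sites.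
  have key : ∀ j : ℕ, ∃ b : ℝ, 0 < b ∧ b < 1 ∧ ∀ᶠ n : ℕ in atTop,
      (∀ y ∈ Finset.Icc (-N : ℤ) N, energy (fun n => w n) x y n ≤ K) →
        ∃ y : ℤ, -N + j ≤ y ∧ (n : ℝ) * exp (-(log n) ^ b) ≤ visits x n y := by
    intro j
    induction j with
    | zero =>
      refine ⟨1 / 2, by norm_num, by norm_num, ?_⟩
      have hN : (0 : ℝ) < 1 / (2 * N + 1) := by positivity
      filter_upwards [tendsto_natCast_atTop_atTop.eventually
        (eventually_exp_neg_rpow_le (a := 1 / 4) (b := 1 / 2) (by norm_num) (by norm_num) hN),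
        eventually_ge_atTop 1] with n hn hn1 _
      by_contra! hcon
      have hlt : ∀ y ∈ Finset.Icc (-N : ℤ) N, (visits x n y : ℝ) ≤
          n * exp (-(log n) ^ (1 / 2 : ℝ)) := fun y hy =>
        (hcon y (by simpa using (Finset.mem_Icc.1 hy).1)).le
      have hs := Finset.sum_le_sum hlt
      rw [← Nat.cast_sum, sum_visits x _ hx, Finset.sum_const, nsmul_eq_mul, Int.card_Icc] at hs
      have hcard : (((N : ℤ) + 1 - -N).toNat : ℝ) = 2 * N + 1 := by
        have : ((N : ℤ) + 1 - -N).toNat = 2 * N + 1 := by omega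
        rw [this]; push_cast; ring
      rw [hcard] at hs
      have h1 : exp (-(log (n : ℝ)) ^ (1 / 4 : ℝ)) ≤ 1 := by
        rw [exp_le_one_iff, neg_nonpos]
        exact rpow_nonneg (log_nonneg (by exact_mod_cast hn1)) _
      have h2 : (2 * N + 1 : ℝ) * (n * exp (-(log n) ^ (1 / 2 : ℝ))) ≤ n := by
        calc (2 * N + 1 : ℝ) * (n * exp (-(log n) ^ (1 / 2 : ℝ)))
            ≤ (2 * N + 1 : ℝ) * (n * (1 / (2 * N + 1) * 1)) := by
              gcongr
              exact hn.trans (by gcongr)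
          _ = n := by field_simp
      push_cast at hs
      linarith
    | succ j ih =>
      obtain ⟨a, a0, a1, h⟩ := ih
      obtain ⟨b, hab, b1⟩ := exists_between a1
      refine ⟨b, a0.trans hab, b1, ?_⟩
      filter_upwards [h, tendsto_natCast_atTop_atTop.eventually
        (hw.eventually_le_of_div_le hlarge a0 hab b1 C), eventually_gt_atTop 0] with n h1 h2 h3 hE
      obtain ⟨y, hy, hv⟩ := h1 hE
      have hyI : y ∈ Finset.Icc (-N : ℤ) N := by
        by_contra hcon
        rw [hzero n y hcon, Nat.cast_zero] at hv
        have : (0 : ℝ) < n := by exact_mod_cast h3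
        have : 0 < (n : ℝ) * exp (-(log n) ^ a) := by positivity
        linarith
      refine ⟨y + 1, by push_cast; linarith, ?_⟩
      exact h2 _ _ (Nat.cast_nonneg _) hv (hC x y n (hE y hyI))
  intro hfreq
  -- After `2N + 1` steps the site found is at least `N + 1`, outside the range.
  obtain ⟨b, -, -, hb⟩ := key (2 * N + 1)
  obtain ⟨n, h1, h2, h3⟩ := (hfreq.and_eventually (hb.and (eventually_gt_atTop 0))).exists
  obtain ⟨y, hy, hv⟩ := h2 h1
  have hyN : y ∉ Finset.Icc (-N : ℤ) N := by
    rw [Finset.mem_Icc]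
    push_cast at hy
    omega
  rw [hzero n y hyN, Nat.cast_zero] at hv
  have : (0 : ℝ) < n := by exact_mod_cast h3
  have : 0 < (n : ℝ) * exp (-(log n) ^ b) := by positivity
  linarith

theorem Localizes.exists_mem_Icc {x : ℕ → ℤ} (hx : Localizes x) :
    ∃ N : ℕ, ∀ n, x n ∈ Finset.Icc (-N : ℤ) N := by
  obtain ⟨N, hN⟩ := (hx.image Int.natAbs).bddAbove
  refine ⟨N, fun n => ?_⟩
  have : (x n).natAbs ≤ N := hN ⟨x n, ⟨n, rfl⟩, rfl⟩
  rw [Finset.mem_Icc]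
  omega

theorem IsVRRW.ae_not_localizes (hw : IsWeightFunction w)
    (hlarge : ∀ᶠ x : ℝ in atTop, w x = x * exp (-(log x / log (log x))))
    {Ω : Type*} [MeasurableSpace Ω] {μ : Measure Ω} [IsProbabilityMeasure μ] {X : ℕ → Ω → ℤ}
    (hX : IsVRRW (fun n : ℕ => w n) X μ) : ∀ᵐ ω ∂μ, ¬ Localizes fun n => X n ω := by
  have h : ∀ᵐ ω ∂μ, ∀ N : ℕ, ∃ K : ℝ, ∃ᶠ n in atTop, ∀ y ∈ Finset.Icc (-N : ℤ) N,
      energy (fun n => w n) (fun k => X k ω) y n ≤ K := by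
    refine ae_all_iff.2 fun N => hX.ae_frequently_energy_le (fun n => hw.pos n n.cast_nonneg)
      (fun n => ?_) _
    simp only [Nat.cast_zero]
    exact hw.zero_le_natCast n
  filter_upwards [h] with ω hω hloc
  obtain ⟨N, hN⟩ := hloc.exists_mem_Icc
  obtain ⟨K, hK⟩ := hω N
  exact hw.not_frequently_energy_le hlarge hN K hK

end Localization
end VRRW

theorem mainTheorem4 (w : ℝ → ℝ) (hw : VRRW.IsWeightFunction w)
    (hlarge : ∀ᶠ x : ℝ in atTop,
      w x = x * Real.exp (-(Real.log x / Real.log (Real.log x)))) :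
    -- `i_-(w) = i_+(w) = +∞`
    (Tendsto (fun η : ℝ => VRRW.index w η) (𝓝[<] (1 / 2 : ℝ)) (𝓝 (⊤ : ℕ∞)) ∧
      Tendsto (fun η : ℝ => VRRW.index w η) (𝓝[>] (1 / 2 : ℝ)) (𝓝 (⊤ : ℕ∞))) ∧
    -- every walk with the weight sequence `(w(n))` almost surely does not localize
    (∀ {Ω : Type*} [MeasurableSpace Ω] (μ : Measure Ω) [IsProbabilityMeasure μ] (X : ℕ → Ω → ℤ),
      VRRW.IsVRRW (fun n : ℕ => w n) X μ →
        ∀ᵐ ω ∂μ, ¬ VRRW.Localizes (fun n => X n ω)) ∧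
    -- `w` grows slower than `x / exp(log^α x)` for every `α < 1`
    (∀ α : ℝ, α < 1 →
      w =o[atTop] fun x : ℝ => x / Real.exp ((Real.log x) ^ α)) := by
  have htop : ∀ᶠ η : ℝ in 𝓝 (1 / 2), VRRW.index w η = ⊤ := by
    filter_upwards [lt_mem_nhds (one_half_pos : (0 : ℝ) < 1 / 2)] with η hη
    exact hw.index_eq_top hlarge hη
  refine ⟨⟨?_, ?_⟩, ?_, fun α hα => VRRW.isLittleO_weight hlarge hα⟩
  · exact tendsto_nhds_of_eventually_eq (htop.filter_mono nhdsWithin_le_nhds)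
  · exact tendsto_nhds_of_eventually_eq (htop.filter_mono nhdsWithin_le_nhds)
  · intro Ω _ μ _ X hX
    exact hX.ae_not_localizes hw hlarge
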